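/- Let \(G\) be a finite connected simple graph on \(n\ge 6\) vertices that is triangle-free, with minimum degree \(\delta(G)\ge \frac n3+1\). Then \[\mathrm{sn}(G)=\mathrm{gon}(G)=n-\alpha_2^c(G),\] where the three invariants are as follows. Dissociation number. \(\alpha_2^c(G)\) is the maximum size of a set \(S\subseteq V(G)\) such that every connected component of the induced subgraph \(G[S]\) has at most \(2\) vertices. Scramble number. A scramble on \(G\) is a collection \(\mathcal S\) of non-empty vertex sets (eggs), each inducing a connected subgraph. Let \(h(\mathcal S)\) be the minimum size of a vertex set meeting every egg, and let \(e(\mathcal S)\) be the minimum, over all \(A\subseteq V(G)\) such that \(A\) and \(A^C=V(G)\setminus A\) each contain an egg, of the number of edges between \(A\) and \(A^C\) (with \(e(\mathcal S)=\infty\) if there is no such \(A\)). Then \(\mathrm{sn}(G)\) is the maximum of \(\min(h(\mathcal S),e(\mathcal S))\) over all scrambles \(\mathcal S\) on \(G\). Gonality. A divisor is a function \(D:V(G)\to\mathbb Z\); its degree is \(\sum_v D(v)\), and it is effective if \(D\ge 0\). The chip-firing move at \(v\) decreases \(D(v)\) by the degree of \(v\) and increases \(D(w)\) by \(1\) for each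 neighbor \(w\) of \(v\). Two divisors are equivalent if one can be transformed into the other by a sequence of chip-firing moves. The rank of \(D\) is \(-1\) if \(D\) is not equivalent to an effective divisor, and otherwise it is the largest integer \(r\ge 0\) such that \(D-E\) is equivalent to an effective divisor for every effective divisor \(E\) of degree \(r\). Then \(\mathrm{gon}(G)\) is the minimum degree of a divisor of positive rank. -/

import Mathlib

namespace SimpleGraph

variable {V : Type*} [Fintype V] [DecidableEq V]

/-! ### Component independence numbers -/

/-- `S` is an `l`-component independent set: every connected component of the induced
subgraph `G[S]` has at most `l` vertices. -/
def IsComponentIndepSet (G : SimpleGraph V) (l : ℕ) (S : Finset V) : Prop :=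
  ∀ c : (G.induce (S : Set V)).ConnectedComponent, c.supp.ncard ≤ l

open Classical in
/-- The `l`-component independence number: the maximum size of an `l`-component independent
set (the empty set always is one). For `l = 2` this is the dissociation number. -/
noncomputable def componentIndepNum (G : SimpleGraph V) (l : ℕ) : ℕ :=
  (Finset.univ.filter (fun S : Finset V => G.IsComponentIndepSet l S)).sup Finset.card

/-! ### Scrambles -/

/-- A scramble is a collection of connected (in particular nonempty) vertex sets, its eggs. -/
def IsScramble (G : SimpleGraph V) (𝓢 : Set (Finset V)) : Prop :=
  ∀ E ∈ 𝓢, (G.induce (E : Set V)).Connected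

/-- A hitting set meets every egg. -/
def IsHittingSet (𝓢 : Set (Finset V)) (C : Finset V) : Prop :=
  ∀ E ∈ 𝓢, (C ∩ E).Nonempty

/-- An egg-cut is a vertex set `A` such that `A` and its complement each contain an egg. -/
def IsEggCut (𝓢 : Set (Finset V)) (A : Finset V) : Prop :=
  (∃ E ∈ 𝓢, E ⊆ A) ∧ ∃ E ∈ 𝓢, E ⊆ Aᶜ

/-- The minimum size of a hitting set. -/
noncomputable def hittingNumber (𝓢 : Set (Finset V)) : ℕ∞ :=
  ⨅ (C : Finset V) (_ : IsHittingSet 𝓢 C), (C.card : ℕ∞)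

/-- The minimum number of edges between `A` and its complement over all egg-cuts `A`
(`⊤` if there is no egg-cut). -/
noncomputable def eggCutNumber (G : SimpleGraph V) [DecidableRel G.Adj]
    (𝓢 : Set (Finset V)) : ℕ∞ :=
  ⨅ (A : Finset V) (_ : IsEggCut 𝓢 A), ((G.interedges A Aᶜ).card : ℕ∞)

/-- The order of a scramble. -/
noncomputable def scrambleOrder (G : SimpleGraph V) [DecidableRel G.Adj]
    (𝓢 : Set (Finset V)) : ℕ∞ :=
  min (hittingNumber 𝓢) (G.eggCutNumber 𝓢)

/-- The scramble number: the maximum order of a scramble. -/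
noncomputable def scrambleNumber (G : SimpleGraph V) [DecidableRel G.Adj] : ℕ∞ :=
  ⨆ (𝓢 : Set (Finset V)) (_ : G.IsScramble 𝓢), G.scrambleOrder 𝓢

/-! ### Divisors, chip-firing and gonality -/

/-- The degree of a divisor `D : V → ℤ`. -/
def divisorDegree (D : V → ℤ) : ℤ := ∑ v, D v

/-- The chip-firing move at `v`. -/
def chipFire (G : SimpleGraph V) [DecidableRel G.Adj] (D : V → ℤ) (v : V) : V → ℤ :=
  fun w => if w = v then D v - G.degree v else D w + if G.Adj v w then 1 else 0

/-- `D` can be transformed into `D'` by a sequence of chip-firing moves. -/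
def DivisorEquiv (G : SimpleGraph V) [DecidableRel G.Adj] (D D' : V → ℤ) : Prop :=
  Relation.ReflTransGen (fun D₁ D₂ : V → ℤ => ∃ v, D₂ = G.chipFire D₁ v) D D'

/-- `D` is equivalent to some effective divisor. -/
def IsWinnable (G : SimpleGraph V) [DecidableRel G.Adj] (D : V → ℤ) : Prop :=
  ∃ D' : V → ℤ, 0 ≤ D' ∧ G.DivisorEquiv D D'

/-- For every effective divisor `E` of degree `r`, the divisor `D - E` is equivalent to an
effective divisor. -/
def RankCondition (G : SimpleGraph V) [DecidableRel G.Adj] (D : V → ℤ) (r : ℕ) : Prop :=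
  ∀ E : V → ℤ, 0 ≤ E → divisorDegree E = r → G.IsWinnable (D - E)

open Classical in
/-- The rank of a divisor: `-1` if it is not equivalent to an effective divisor, and otherwise
the largest `r` satisfying the rank condition. -/
noncomputable def divisorRank (G : SimpleGraph V) [DecidableRel G.Adj] (D : V → ℤ) : ℤ :=
  if G.IsWinnable D then ((sSup {r : ℕ | G.RankCondition D r} : ℕ) : ℤ) else -1

/-- The (divisorial) gonality: the minimum degree of a divisor of positive rank. -/
noncomputable def gonality (G : SimpleGraph V) [DecidableRel G.Adj] : ℕ :=
  sInf {d : ℕ | ∃ D : V → ℤ, divisorDegree D = d ∧ 0 < G.divisorRank D}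

/-! ### The extrema in the definitions of rank and gonality are attained -/

theorem divisorDegree_chipFire (G : SimpleGraph V) [DecidableRel G.Adj] (D : V → ℤ) (v : V) :
    divisorDegree (G.chipFire D v) = divisorDegree D := by
  have h : ∀ w, G.chipFire D v w =
      D w + ((if G.Adj v w then 1 else 0) - if w = v then (G.degree v : ℤ) else 0) := by
    intro w
    unfold chipFire
    by_cases hw : w = v
    · subst hw; simp [sub_eq_add_neg]
    · simp [hw]
  simp only [divisorDegree, h, Finset.sum_add_distrib, Finset.sum_sub_distrib]
  simp [Finset.sum_boole, ← G.card_neighborFinset_eq_degree, neighborFinset_eq_filter]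

theorem DivisorEquiv.degree_eq {G : SimpleGraph V} [DecidableRel G.Adj] {D D' : V → ℤ}
    (h : G.DivisorEquiv D D') : divisorDegree D' = divisorDegree D := by
  induction h with
  | refl => rfl
  | tail _ h ih =>
    obtain ⟨v, rfl⟩ := h
    rw [divisorDegree_chipFire, ih]

theorem IsWinnable.degree_nonneg {G : SimpleGraph V} [DecidableRel G.Adj] {D : V → ℤ}
    (h : G.IsWinnable D) : 0 ≤ divisorDegree D := by
  obtain ⟨D', h0, h1⟩ := h
  rw [← h1.degree_eq]
  exact Finset.sum_nonneg fun v _ => h0 v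

theorem bddAbove_rankCondition [Nonempty V] (G : SimpleGraph V) [DecidableRel G.Adj]
    (D : V → ℤ) : BddAbove {r : ℕ | G.RankCondition D r} := by
  refine ⟨(divisorDegree D).toNat, fun r hr => ?_⟩
  obtain ⟨v⟩ := ‹Nonempty V›
  have h := (hr (Pi.single v (r : ℤ)) (by simp) (by simp [divisorDegree])).degree_nonneg
  simp [divisorDegree, Finset.sum_sub_distrib] at h
  simp only [divisorDegree]
  omega

theorem rankCondition_divisorRank [Nonempty V] (G : SimpleGraph V) [DecidableRel G.Adj]
    {D : V → ℤ} (h : G.IsWinnable D) :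
    ∃ r : ℕ, G.divisorRank D = r ∧ IsGreatest {r : ℕ | G.RankCondition D r} r := by
  refine ⟨_, if_pos h, Nat.sSup_mem ⟨0, ?_⟩ (G.bddAbove_rankCondition D),
    fun r hr => le_csSup (G.bddAbove_rankCondition D) hr⟩
  intro E hE hd
  have : E = 0 := by
    funext v
    have := (Finset.sum_eq_zero_iff_of_nonneg (fun v _ => hE v)).1
      (show ∑ v, E v = 0 by simpa [divisorDegree] using hd) v (Finset.mem_univ v)
    simpa using this
  simpa [this] using h

theorem gonality_isLeast [Nonempty V] (G : SimpleGraph V) [DecidableRel G.Adj] :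
    IsLeast {d : ℤ | ∃ D : V → ℤ, divisorDegree D = d ∧ 0 < G.divisorRank D}
      (G.gonality : ℤ) := by
  constructor
  · refine Nat.sInf_mem (s := {d : ℕ | ∃ D : V → ℤ, divisorDegree D = d ∧ 0 < G.divisorRank D})
      ⟨Fintype.card V, fun _ => 1, by simp [divisorDegree], ?_⟩
    have hw : G.IsWinnable (fun _ => 1) :=
      ⟨fun _ => 1, fun _ => by simp, Relation.ReflTransGen.refl⟩
    obtain ⟨r, h1, h2⟩ := G.rankCondition_divisorRank hw
    have : 1 ≤ r := h2.2 fun E hE hd => ⟨_, fun v => ?_, Relation.ReflTransGen.refl⟩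
    · omega
    · have := Finset.single_le_sum (fun v _ => hE v) (Finset.mem_univ v)
      simp only [divisorDegree] at hd
      simp only [Pi.zero_apply, Pi.sub_apply]
      push_cast at hd
      linarith
  · rintro d ⟨D, hd, hr⟩
    have hw : G.IsWinnable D := by
      by_contra h
      simp [divisorRank, h] at hr
    have h0 := hw.degree_nonneg
    have : G.gonality ≤ d.toNat := Nat.sInf_le ⟨D, by omega, hr⟩
    omega

end SimpleGraph

set_option linter.unusedSectionVars false

/-! Write n for the order, δ for the minimum degree and α for the dissociation number. The proof
closes the cycle n - α ≤ sn ≤ gon ≤ n - α.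

sn ≤ gon holds for every nonempty graph (`scrambleOrder_le_of_divisorRank_pos`). Among the effective
divisors equivalent to one of positive rank, take one hitting the most eggs. If it misses an egg E,
chips travel to E by firing an increasing chain of level sets. The set fired when E is first hit is
disjoint from E. By maximality some other egg has been lost by then, and the set fired when it was
lost contains it. So the later level set is an egg-cut, and firing it legally costs at least as many
chips as it has boundary edges.

gon ≤ n - α: put one chip on each vertex outside a maximum dissociation set S. To reach a vertex of
S, fire everything except its component in G[S]. This is legal because an outside vertex sees at
most one end of an edge.

n - α ≤ sn: use all connected sets with at least three vertices as eggs. Hitting sets are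
complements of dissociation sets. Both sides of an egg-cut have at least three vertices, so Mantel's
theorem gives at least n - δ edges across; and δ ≤ α since neighborhoods are independent. -/

namespace SimpleGraph

/-! ### Firing scripts and divisor equivalence -/

section Firing

variable {V : Type*} [Fintype V] [DecidableEq V] (G : SimpleGraph V) [DecidableRel G.Adj]

/-- Fire each vertex `v` exactly `f v` times. -/
def fireScript (D f : V → ℤ) : V → ℤ :=
  fun w => D w - ∑ u ∈ G.neighborFinset w, (f w - f u)

theorem fireScript_zero (D : V → ℤ) : G.fireScript D 0 = D := by
  funext w; simp [fireScript]

theorem fireScript_fireScript (D f g : V → ℤ) :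
    G.fireScript (G.fireScript D f) g = G.fireScript D (f + g) := by
  funext w
  simp only [fireScript, Pi.add_apply, Finset.sum_sub_distrib, Finset.sum_add_distrib]
  ring

theorem fireScript_add_const (D f : V → ℤ) (c : ℤ) :
    G.fireScript D (fun v => f v + c) = G.fireScript D f := by
  funext w; simp [fireScript]

theorem chipFire_eq_fireScript (D : V → ℤ) (v : V) :
    G.chipFire D v = G.fireScript D (Pi.single v 1) := by
  funext w
  simp only [fireScript, chipFire, Finset.sum_sub_distrib]
  by_cases hw : w = v
  · subst hw
    have : ∑ u ∈ G.neighborFinset w, (Pi.single w (1 : ℤ) : V → ℤ) u = 0 :=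
      Finset.sum_eq_zero fun u hu => by
        rw [mem_neighborFinset] at hu
        simp [hu.ne']
    rw [this]
    simp
  · have : ∑ u ∈ G.neighborFinset w, (Pi.single v (1 : ℤ) : V → ℤ) u =
        if G.Adj v w then 1 else 0 := by
      simp [Pi.single_apply, G.adj_comm]
    rw [this]
    simp [hw]

variable {G}

theorem DivisorEquiv.exists_fireScript {D D' : V → ℤ} (h : G.DivisorEquiv D D') :
    ∃ f, D' = G.fireScript D f := by
  induction h with
  | refl => exact ⟨0, (G.fireScript_zero D).symm⟩
  | tail _ h ih =>
    obtain ⟨v, rfl⟩ := h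
    obtain ⟨f, rfl⟩ := ih
    exact ⟨_, by rw [chipFire_eq_fireScript, fireScript_fireScript]⟩

theorem divisorEquiv_fireScript_of_nonneg (D : V → ℤ) (n : ℕ) :
    ∀ f : V → ℤ, 0 ≤ f → ∑ v, f v = n → G.DivisorEquiv D (G.fireScript D f) := by
  induction n with
  | zero =>
    intro f hf hs
    have : f = 0 := by
      funext v
      exact (Finset.sum_eq_zero_iff_of_nonneg (fun v _ => hf v)).1 (by simpa using hs) v
        (Finset.mem_univ v)
    rw [this, fireScript_zero]
    exact Relation.ReflTransGen.refl
  | succ n ih =>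
    intro f hf hs
    obtain ⟨v, -, hv⟩ : ∃ v ∈ Finset.univ, 0 < f v := by
      apply Finset.exists_lt_of_sum_lt (f := fun _ => (0 : ℤ))
      rw [hs]; simp
    refine Relation.ReflTransGen.tail (ih (f - Pi.single v 1) ?_ ?_) ⟨v, ?_⟩
    · intro w
      by_cases hw : w = v
      · subst hw
        simp only [Pi.zero_apply, Pi.sub_apply, Pi.single_eq_same]
        omega
      · simpa [hw] using hf w
    · simp [Finset.sum_sub_distrib, hs]
    · rw [chipFire_eq_fireScript, fireScript_fireScript, sub_add_cancel]

theorem divisorEquiv_fireScript (D f : V → ℤ) : G.DivisorEquiv D (G.fireScript D f) := by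
  -- Firing every vertex equally often changes nothing, so this shift makes the script nonnegative
  -- at no cost.
  rw [← G.fireScript_add_const D f (∑ v, |f v|)]
  have h0 : ∀ v, 0 ≤ f v + ∑ v, |f v| := fun v => by
    have := Finset.single_le_sum (fun v _ => abs_nonneg (f v)) (Finset.mem_univ v)
    have := neg_abs_le (f v)
    omega
  exact divisorEquiv_fireScript_of_nonneg D (∑ v, (f v + ∑ v, |f v|)).toNat _ h0
    (Int.toNat_of_nonneg (Finset.sum_nonneg fun v _ => h0 v)).symm

theorem fireScript_sub (D E f : V → ℤ) :
    G.fireScript (D - E) f = G.fireScript D f - E := by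
  funext w; simp only [fireScript, Pi.sub_apply]; ring

/-- A divisor of positive rank can reach every vertex by an effective divisor. -/
theorem exists_fireScript_of_divisorRank_pos [Nonempty V] {D : V → ℤ}
    (h : 0 < G.divisorRank D) (v : V) :
    ∃ f, 0 ≤ G.fireScript D f ∧ 0 < G.fireScript D f v := by
  have hw : G.IsWinnable D := by
    by_contra hw
    simp [divisorRank, hw] at h
  obtain ⟨r, hr, hg⟩ := G.rankCondition_divisorRank hw
  have hr0 : 0 < r := by omega
  obtain ⟨D', h0, hD'⟩ := hg.1 (Pi.single v (r : ℤ)) (by simp) (by simp [divisorDegree])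
  obtain ⟨f, rfl⟩ := hD'.exists_fireScript
  rw [fireScript_sub] at h0
  refine ⟨f, fun w => ?_, ?_⟩
  · have := h0 w
    by_cases hw : w = v
    · subst hw; simp at this ⊢; omega
    · simpa [hw] using this
  · have := h0 v
    simp at this
    omega

/-- An effective divisor from which every vertex can be reached by one effective firing has
positive rank. -/
theorem divisorRank_pos_of_forall [Nonempty V] {D : V → ℤ} (hD : 0 ≤ D)
    (h : ∀ v, ∃ f, 0 ≤ G.fireScript D f ∧ 0 < G.fireScript D f v) : 0 < G.divisorRank D := by
  obtain ⟨r, hr, hg⟩ :=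
    G.rankCondition_divisorRank (D := D) ⟨D, hD, Relation.ReflTransGen.refl⟩
  have : 1 ≤ r := hg.2 fun E hE hd => by
    obtain ⟨v, -, hv⟩ : ∃ v ∈ Finset.univ, 0 < E v := by
      apply Finset.exists_lt_of_sum_lt (f := fun _ => (0 : ℤ))
      simp only [divisorDegree] at hd
      rw [hd]; simp
    obtain ⟨f, hf, hfv⟩ := h v
    refine ⟨_, fun w => ?_, divisorEquiv_fireScript (D - E) f⟩
    rw [fireScript_sub]
    simp only [divisorDegree] at hd
    have h1 := hf w
    by_cases hw : w = v
    · subst hw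
      have := Finset.single_le_sum (fun v _ => hE v) (Finset.mem_univ w)
      simp only [Pi.zero_apply, Pi.sub_apply]
      push_cast at hd
      omega
    · have := Finset.add_le_sum (fun v _ => hE v) (Finset.mem_univ w) (Finset.mem_univ v) hw
      have h2 := hE w
      simp only [Pi.zero_apply, Pi.sub_apply] at h1 h2 ⊢
      push_cast at hd
      omega
  omega

theorem divisorDegree_fireScript (D f : V → ℤ) :
    divisorDegree (G.fireScript D f) = divisorDegree D :=
  (divisorEquiv_fireScript D f).degree_eq

end Firing

/-! ### Scramble number is at most gonality -/

section ScrambleLeGonality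

variable {V : Type*} [Fintype V] [DecidableEq V] {G : SimpleGraph V} [DecidableRel G.Adj]

/-- The `t`-th truncation of a firing script from one effective divisor to another leads to an
effective divisor. -/
theorem fireScript_truncate_nonneg {D f : V → ℤ} (h0 : 0 ≤ D) (h1 : 0 ≤ G.fireScript D f)
    (t : ℤ) : 0 ≤ G.fireScript D (fun v => max (f v - t) 0) := by
  intro w
  -- At or below level t a vertex only gains chips; above it, truncation only shrinks its losses,
  -- which the full script already affords.
  rcases le_total (f w) t with h | h
  · have h2 : ∑ u ∈ G.neighborFinset w, (max (f w - t) 0 - max (f u - t) 0) ≤ 0 :=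
      Finset.sum_nonpos fun u _ => by omega
    have := h0 w
    simp only [Pi.zero_apply, fireScript] at this ⊢
    omega
  · have h2 : ∑ u ∈ G.neighborFinset w, (max (f w - t) 0 - max (f u - t) 0) ≤
        ∑ u ∈ G.neighborFinset w, (f w - f u) :=
      Finset.sum_le_sum fun u _ => by omega
    have := h1 w
    simp only [Pi.zero_apply, fireScript] at this ⊢
    omega

/-- The indicator firing script of a vertex set. -/
def indicatorScript (U : Finset V) : V → ℤ := fun v => if v ∈ U then 1 else 0

theorem fireScript_truncate_sub_one (D f : V → ℤ) (t : ℤ) :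
    G.fireScript D (fun v => max (f v - (t - 1)) 0) =
      G.fireScript (G.fireScript D (fun v => max (f v - t) 0))
        (indicatorScript (Finset.univ.filter fun v => t ≤ f v)) := by
  rw [fireScript_fireScript]
  congr 1
  funext v
  simp only [indicatorScript, Pi.add_apply, Finset.mem_filter, Finset.mem_univ, true_and]
  split_ifs <;> omega

theorem fireScript_indicator_of_mem (D : V → ℤ) {U : Finset V} {w : V} (hw : w ∈ U) :
    G.fireScript D (indicatorScript U) w = D w - (Uᶜ.filter (G.Adj w)).card := by
  have : ∑ u ∈ G.neighborFinset w, (indicatorScript U w - indicatorScript U u) =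
      ∑ u ∈ G.neighborFinset w, if u ∈ U then (0 : ℤ) else 1 :=
    Finset.sum_congr rfl fun u _ => by
      simp only [indicatorScript, hw, if_true]; split_ifs <;> rfl
  rw [fireScript, this, neighborFinset_eq_filter, Finset.sum_filter, Finset.card_filter]
  push_cast
  rw [← Finset.sum_filter_add_sum_filter_not Finset.univ (· ∈ U),
    Finset.sum_eq_zero (s := Finset.univ.filter (· ∈ U)) (fun x hx => by simp_all), zero_add]
  congr 1
  apply Finset.sum_congr
  · ext; simp
  · intro x hx; simp_all

theorem fireScript_indicator_of_notMem (D : V → ℤ) {U : Finset V} {w : V} (hw : w ∉ U) :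
    G.fireScript D (indicatorScript U) w = D w + (U.filter (G.Adj w)).card := by
  have : ∑ u ∈ G.neighborFinset w, (indicatorScript U w - indicatorScript U u) =
      - ∑ u ∈ G.neighborFinset w, if u ∈ U then (1 : ℤ) else 0 := by
    rw [← Finset.sum_neg_distrib]
    exact Finset.sum_congr rfl fun u _ => by
      simp only [indicatorScript, hw, if_false]; split_ifs <;> simp
  rw [fireScript, this, ← Finset.sum_filter, Finset.sum_const, sub_neg_eq_add]
  simp only [nsmul_eq_mul, mul_one]
  congr 3
  ext; simp [and_comm]

theorem card_interedges_eq_sum (A B : Finset V) :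
    (G.interedges A B).card = ∑ a ∈ A, (B.filter (G.Adj a)).card := by
  simp only [interedges_def, Finset.card_filter, Finset.sum_product]

/-- Legally firing `U` needs at least as many chips as there are edges leaving `U`. -/
theorem card_interedges_le_divisorDegree {D : V → ℤ} (h0 : 0 ≤ D) {U : Finset V}
    (h1 : 0 ≤ G.fireScript D (indicatorScript U)) :
    ((G.interedges U Uᶜ).card : ℤ) ≤ divisorDegree D := by
  rw [card_interedges_eq_sum]
  push_cast
  calc ∑ a ∈ U, ((Uᶜ.filter (G.Adj a)).card : ℤ) ≤ ∑ a ∈ U, D a :=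
        Finset.sum_le_sum fun a ha => by
          have := h1 a
          rw [fireScript_indicator_of_mem D ha] at this
          simpa using this
    _ ≤ ∑ a, D a :=
        Finset.sum_le_sum_of_subset_of_nonneg (Finset.subset_univ _) fun a _ _ => h0 a

theorem exists_adj_of_connected_induce {E U : Finset V} (hE : (G.induce (E : Set V)).Connected)
    {x y : V} (hx : x ∈ E) (hxU : x ∈ U) (hy : y ∈ E) (hyU : y ∉ U) :
    ∃ a b, a ∈ E ∧ a ∈ U ∧ b ∈ E ∧ b ∉ U ∧ G.Adj a b := by
  obtain ⟨p⟩ := hE.preconnected ⟨x, hx⟩ ⟨y, hy⟩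
  obtain ⟨d, -, h1, h2⟩ := p.exists_boundary_dart {v | (v : V) ∈ U} hxU hyU
  exact ⟨d.fst, d.snd, d.fst.2, h1, d.snd.2, h2, d.adj⟩

/-- A connected set that loses all its chips when `U` is fired lies in `U`. -/
theorem subset_of_fireScript_loses {D : V → ℤ} (h0 : 0 ≤ D) {U E : Finset V}
    (hE : (G.induce (E : Set V)).Connected)
    (hit : ∃ v ∈ E, 0 < D v) (miss : ∀ v ∈ E, G.fireScript D (indicatorScript U) v = 0) :
    E ⊆ U := by
  intro y hy
  by_contra hyU
  obtain ⟨x, hx, hDx⟩ := hit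
  have hxU : x ∈ U := by
    by_contra hxU
    have := miss x hx
    rw [fireScript_indicator_of_notMem D hxU] at this
    omega
  obtain ⟨a, b, -, haU, hb, hbU, hab⟩ := exists_adj_of_connected_induce hE hx hxU hy hyU
  have h1 := miss b hb
  rw [fireScript_indicator_of_notMem D hbU] at h1
  have h2 : 0 < (U.filter (G.Adj b)).card :=
    Finset.card_pos.2 ⟨a, by simp [haU, hab.symm]⟩
  have h3 := h0 b
  simp at h3
  omega

/-- A connected set that gains its first chips when `U` is fired is disjoint from `U`. -/
theorem subset_compl_of_fireScript_gains {D : V → ℤ} {U E : Finset V}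
    (h1 : 0 ≤ G.fireScript D (indicatorScript U))
    (hE : (G.induce (E : Set V)).Connected)
    (miss : ∀ v ∈ E, D v = 0) (hit : ∃ v ∈ E, 0 < G.fireScript D (indicatorScript U) v) :
    E ⊆ Uᶜ := by
  -- Firing the complement undoes firing `U`, so gaining chips is losing them in reverse.
  have key : G.fireScript (G.fireScript D (indicatorScript U)) (indicatorScript Uᶜ) = D := by
    rw [fireScript_fireScript]
    have : indicatorScript U + indicatorScript Uᶜ = fun v => (0 : V → ℤ) v + 1 := by
      funext v
      by_cases hv : v ∈ U <;> simp [indicatorScript, hv]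
    rw [this, fireScript_add_const, fireScript_zero]
  exact subset_of_fireScript_loses h1 hE hit (by rwa [key])

open Classical in
/-- The eggs of a scramble hit by the support of a divisor. -/
noncomputable def hitEggs (𝓢 : Set (Finset V)) (D : V → ℤ) : Finset (Finset V) :=
  Finset.univ.filter fun E => E ∈ 𝓢 ∧ ∃ v ∈ E, 0 < D v

theorem mem_hitEggs {𝓢 : Set (Finset V)} {D : V → ℤ} {E : Finset V} :
    E ∈ hitEggs 𝓢 D ↔ E ∈ 𝓢 ∧ ∃ v ∈ E, 0 < D v := by
  simp [hitEggs]

theorem hittingNumber_le_divisorDegree {𝓢 : Set (Finset V)} {D : V → ℤ} (h0 : 0 ≤ D)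
    (hit : ∀ E ∈ 𝓢, ∃ v ∈ E, 0 < D v) {d : ℕ} (hd : divisorDegree D = d) :
    hittingNumber 𝓢 ≤ d := by
  refine (iInf₂_le (Finset.univ.filter fun v => 0 < D v) ?_).trans ?_
  · intro E hE
    obtain ⟨v, hv, hD⟩ := hit E hE
    exact ⟨v, by simp [hv, hD]⟩
  · have : ((Finset.univ.filter fun v => 0 < D v).card : ℤ) ≤ divisorDegree D := by
      rw [Finset.card_filter, divisorDegree]
      push_cast
      exact Finset.sum_le_sum fun v _ => by
        have := h0 v
        simp only [Pi.zero_apply] at this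
        split_ifs <;> omega
    exact_mod_cast hd ▸ this

/-- The order of a scramble is at most the degree of any divisor of positive rank. -/
theorem scrambleOrder_le_of_divisorRank_pos [Nonempty V] {𝓢 : Set (Finset V)}
    (h𝓢 : G.IsScramble 𝓢) {D : V → ℤ} (hD : 0 < G.divisorRank D) {d : ℕ}
    (hd : divisorDegree D = d) : G.scrambleOrder 𝓢 ≤ d := by
  have hne : ∃ m, ∃ f, 0 ≤ G.fireScript D f ∧ (hitEggs 𝓢 (G.fireScript D f)).card = m := by
    obtain ⟨f, hf, -⟩ := exists_fireScript_of_divisorRank_pos hD (Classical.arbitrary V)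
    exact ⟨_, f, hf, rfl⟩
  obtain ⟨f₀, hf₀, hmax⟩ : ∃ f₀, 0 ≤ G.fireScript D f₀ ∧ ∀ f, 0 ≤ G.fireScript D f →
      (hitEggs 𝓢 (G.fireScript D f)).card ≤ (hitEggs 𝓢 (G.fireScript D f₀)).card := by
    have hfin : {m | ∃ f, 0 ≤ G.fireScript D f ∧
        (hitEggs 𝓢 (G.fireScript D f)).card = m}.Finite := by
      refine (Set.finite_Iic (Fintype.card (Finset V))).subset ?_
      rintro m ⟨f, -, rfl⟩
      exact Finset.card_le_univ _
    obtain ⟨m, ⟨f, hf, rfl⟩, hm⟩ := hfin.exists_maximal hne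
    refine ⟨f, hf, fun g hg => ?_⟩
    by_contra! hlt
    exact absurd (hm ⟨g, hg, rfl⟩ hlt.le) (by simpa using hlt)
  set D₀ := G.fireScript D f₀ with hD₀
  have hd₀ : divisorDegree D₀ = d := by rw [hD₀, divisorDegree_fireScript, hd]
  by_cases hall : ∀ E ∈ 𝓢, ∃ v ∈ E, 0 < D₀ v
  · exact (min_le_left _ _).trans (hittingNumber_le_divisorDegree hf₀ hall hd₀)
  push Not at hall
  obtain ⟨E, hE, hmiss⟩ := hall
  obtain ⟨⟨v, hv⟩⟩ := (h𝓢 E hE).nonempty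
  obtain ⟨g, hg0, hgv⟩ := exists_fireScript_of_divisorRank_pos hD v
  obtain ⟨f, hf⟩ : ∃ f, G.fireScript D₀ f = G.fireScript D g :=
    ⟨g - f₀, by rw [hD₀, fireScript_fireScript]; simp⟩
  have hf0 : 0 ≤ G.fireScript D₀ f := by rwa [hf]
  -- `W k` is the divisor after firing the `k` highest level sets of `f`
  set M : ℤ := ∑ v, |f v| with hM
  have hfM : ∀ v, |f v| ≤ M := fun v =>
    Finset.single_le_sum (fun v _ => abs_nonneg (f v)) (Finset.mem_univ v)
  let W : ℕ → V → ℤ := fun k => G.fireScript D₀ (fun v => max (f v - (M - k)) 0)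
  let U : ℕ → Finset V := fun k => Finset.univ.filter fun v => M - k ≤ f v
  have hW0 : ∀ k, 0 ≤ W k := fun k => fireScript_truncate_nonneg hf₀ hf0 _
  have hWD : ∀ k, ∃ h, W k = G.fireScript D h := fun k =>
    ⟨_, by simp only [W]; rw [hD₀, fireScript_fireScript]⟩
  have hW_zero : W 0 = D₀ := by
    have : (fun v => max (f v - (M - (0 : ℕ))) 0) = (0 : V → ℤ) := by
      funext v
      have := (abs_le.1 (hfM v)).2
      simp; omega
    simp only [W]; rw [this, fireScript_zero]
  have hW_succ : ∀ k, W (k + 1) = G.fireScript (W k) (indicatorScript (U k)) := fun k => by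
    have := fireScript_truncate_sub_one (G := G) D₀ f (M - k)
    simp only [W, U]
    rw [← this]
    congr 1
    funext v
    push_cast
    congr 1
    ring
  have hW_last : W (2 * M).toNat = G.fireScript D₀ f := by
    have hM0 : 0 ≤ M := (abs_nonneg _).trans (hfM v)
    -- The threshold is now -M, below every value of `f`, so nothing is truncated.
    have : (fun v => max (f v - (M - ((2 * M).toNat : ℕ))) 0) = fun v => f v + M := by
      funext v
      have := (abs_le.1 (hfM v)).1
      rw [Int.toNat_of_nonneg (by omega)]
      omega
    simp only [W]; rw [this, fireScript_add_const]
  have hUmono : ∀ {i j}, i ≤ j → U i ⊆ U j := fun {i j} hij w hw => by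
    simp only [U, Finset.mem_filter, Finset.mem_univ, true_and] at hw ⊢
    omega
  have hex : ∃ k, ∃ v ∈ E, 0 < W k v := ⟨_, v, hv, by rw [hW_last, hf]; exact hgv⟩
  classical
  obtain ⟨k, hk⟩ : ∃ k, Nat.find hex = k + 1 := by
    refine Nat.exists_eq_succ_of_ne_zero fun h => ?_
    obtain ⟨w, hw, hpos⟩ := Nat.find_spec hex
    rw [h, hW_zero] at hpos
    exact absurd hpos (not_lt.2 (hmiss w hw))
  have hkhit : ∃ v ∈ E, 0 < W (k + 1) v := hk ▸ Nat.find_spec hex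
  have hkmiss : ∀ v ∈ E, W k v = 0 := fun w hw => by
    have h1 := Nat.find_min hex (m := k) (by omega)
    push Not at h1
    exact le_antisymm (h1 w hw) (hW0 k w)
  have hEU : E ⊆ (U k)ᶜ := by
    refine subset_compl_of_fireScript_gains ?_ (h𝓢 E hE) hkmiss ?_
    · rw [← hW_succ]; exact hW0 _
    · rw [← hW_succ]; exact hkhit
  -- by maximality some egg hit by `D₀` is no longer hit
  obtain ⟨E', hE'0, hE'1⟩ : ∃ E' ∈ hitEggs 𝓢 D₀, E' ∉ hitEggs 𝓢 (W (k + 1)) := by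
    by_contra! hsub
    have h1 : insert E (hitEggs 𝓢 D₀) ⊆ hitEggs 𝓢 (W (k + 1)) :=
      Finset.insert_subset (mem_hitEggs.2 ⟨hE, hkhit⟩) hsub
    have h2 : E ∉ hitEggs 𝓢 D₀ := fun h => by
      obtain ⟨w, hw, hpos⟩ := (mem_hitEggs.1 h).2
      exact absurd hpos (not_lt.2 (hmiss w hw))
    have h3 := Finset.card_le_card h1
    rw [Finset.card_insert_of_notMem h2] at h3
    obtain ⟨h, hh⟩ := hWD (k + 1)
    have h4 := hmax h (hh ▸ hW0 _)
    rw [← hh] at h4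
    omega
  obtain ⟨hE', hE'hit⟩ := mem_hitEggs.1 hE'0
  have hE'miss : ¬ ∃ v ∈ E', 0 < W (k + 1) v := fun h => hE'1 (mem_hitEggs.2 ⟨hE', h⟩)
  have hex' : ∃ j, ¬ ∃ v ∈ E', 0 < W j v := ⟨k + 1, hE'miss⟩
  obtain ⟨j, hj⟩ : ∃ j, Nat.find hex' = j + 1 := by
    refine Nat.exists_eq_succ_of_ne_zero fun h => ?_
    have := Nat.find_spec hex'
    rw [h, hW_zero] at this
    exact this hE'hit
  have hjk : j ≤ k := by
    have := Nat.find_min' hex' hE'miss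
    omega
  -- `E'` loses its last chips when `U j` is fired, hence lies in `U j`; nestedness carries it into
  -- `U k`.
  have hE'U : E' ⊆ U k := by
    refine (subset_of_fireScript_loses (hW0 j) (h𝓢 E' hE') ?_ ?_).trans (hUmono hjk)
    · exact not_not.1 (Nat.find_min hex' (m := j) (by omega))
    · intro w hw
      rw [← hW_succ]
      have := Nat.find_spec hex'
      rw [hj] at this
      push Not at this
      exact le_antisymm (this w hw) (hW0 _ w)
  refine (min_le_right _ _).trans ((iInf₂_le (U k) ⟨⟨E', hE', hE'U⟩, ⟨E, hE, hEU⟩⟩).trans ?_)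
  have h1 := card_interedges_le_divisorDegree (G := G) (hW0 k) (U := U k)
    (by rw [← hW_succ]; exact hW0 _)
  obtain ⟨h, hh⟩ := hWD k
  rw [hh, divisorDegree_fireScript, hd] at h1
  exact_mod_cast h1

/-- The scramble number is a lower bound for the gonality. -/
theorem scrambleNumber_le_gonality [Nonempty V] : G.scrambleNumber ≤ (G.gonality : ℕ∞) := by
  obtain ⟨D, hd, hr⟩ := G.gonality_isLeast.1
  exact iSup₂_le fun 𝓢 h𝓢 => scrambleOrder_le_of_divisorRank_pos h𝓢 hr hd

end ScrambleLeGonality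

/-! ### Dissociation sets and the upper bound on gonality -/

section Dissociation

variable {V : Type*} [Fintype V] [DecidableEq V] {G : SimpleGraph V}

theorem IsComponentIndepSet.eq_of_adj_of_adj {S : Finset V} (hS : G.IsComponentIndepSet 2 S)
    {x y z : V} (hx : x ∈ S) (hy : y ∈ S) (hz : z ∈ S) (hxy : G.Adj x y) (hxz : G.Adj x z) :
    y = z := by
  by_contra hyz
  let x' : (S : Set V) := ⟨x, hx⟩
  let y' : (S : Set V) := ⟨y, hy⟩
  let z' : (S : Set V) := ⟨z, hz⟩
  have hxy' : (G.induce (S : Set V)).Adj x' y' := hxy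
  have hxz' : (G.induce (S : Set V)).Adj x' z' := hxz
  have hsub : ({x', y', z'} : Set (S : Set V)) ⊆
      ((G.induce (S : Set V)).connectedComponentMk x').supp := by
    rintro w (rfl | rfl | rfl)
    · rfl
    · exact ConnectedComponent.sound hxy'.reachable.symm
    · exact ConnectedComponent.sound hxz'.reachable.symm
  have h1 := Set.ncard_le_ncard hsub (Set.toFinite _)
  have h2 : ({x', y', z'} : Set (S : Set V)).ncard = 3 :=
    Set.ncard_eq_three.2 ⟨x', y', z', hxy'.ne, hxz'.ne, fun h => hyz (congrArg Subtype.val h), rfl⟩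
  have := hS ((G.induce (S : Set V)).connectedComponentMk x')
  omega

theorem isComponentIndepSet_of_forall_not_adj {S : Finset V} {l : ℕ} (hl : 1 ≤ l)
    (hS : ∀ x ∈ S, ∀ y ∈ S, ¬ G.Adj x y) : G.IsComponentIndepSet l S := by
  intro c
  refine ((Set.ncard_le_one_iff (Set.toFinite _)).2 ?_).trans hl
  intro a b ha hb
  by_contra hab
  obtain ⟨p⟩ : (G.induce (S : Set V)).Reachable a b :=
    ConnectedComponent.exact (ha.trans hb.symm)
  cases p with
  | nil => exact hab rfl
  | cons h _ => exact hS _ a.2 _ (Subtype.property _) h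

theorem IsComponentIndepSet.card_le_componentIndepNum {S : Finset V} {l : ℕ}
    (hS : G.IsComponentIndepSet l S) : S.card ≤ G.componentIndepNum l := by
  classical
  exact Finset.le_sup (f := Finset.card) (by simpa using hS)

theorem exists_card_eq_componentIndepNum (G : SimpleGraph V) (l : ℕ) :
    ∃ S : Finset V, G.IsComponentIndepSet l S ∧ S.card = G.componentIndepNum l := by
  classical
  have hne : (Finset.univ.filter fun S : Finset V => G.IsComponentIndepSet l S).Nonempty := by
    refine ⟨∅, ?_⟩
    simp only [Finset.mem_filter, Finset.mem_univ, true_and]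
    intro c
    obtain ⟨⟨v, hv⟩, -⟩ := c.nonempty_supp
    simp at hv
  obtain ⟨S, hS, h⟩ := Finset.exists_mem_eq_sup _ hne Finset.card
  exact ⟨S, by simpa using hS, h.symm⟩

variable [DecidableRel G.Adj]

/-- One chip on each vertex outside a dissociation set gives a divisor of positive rank. -/
theorem divisorRank_pos_of_isComponentIndepSet (htri : G.CliqueFree 3)
    (hδ : 2 ≤ G.minDegree) {S : Finset V} [Nonempty V] (hS : G.IsComponentIndepSet 2 S) :
    0 < G.divisorRank (indicatorScript Sᶜ) := by
  have h0 : (0 : V → ℤ) ≤ indicatorScript Sᶜ := fun v => by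
    simp only [indicatorScript, Pi.zero_apply]; split_ifs <;> simp
  refine divisorRank_pos_of_forall h0 fun v => ?_
  by_cases hv : v ∉ S
  · exact ⟨0, by rwa [fireScript_zero], by rw [fireScript_zero]; simp [indicatorScript, hv]⟩
  push Not at hv
  -- `T` is the component of `v` in G[S]: a vertex or an edge.
  set T : Finset V := insert v (S.filter (G.Adj v)) with hT
  have hTS : T ⊆ S := Finset.insert_subset hv (Finset.filter_subset _ _)
  have hTadj : ∀ x ∈ T, ∀ y ∈ T, x ≠ y → G.Adj x y := by
    intro x hx y hy hxy
    simp only [hT, Finset.mem_insert, Finset.mem_filter] at hx hy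
    rcases hx with rfl | ⟨hx, hvx⟩ <;> rcases hy with rfl | ⟨hy, hvy⟩
    · exact absurd rfl hxy
    · exact hvy
    · exact hvx.symm
    · exact absurd (hS.eq_of_adj_of_adj hv hx hy hvx hvy) hxy
  have hTclosed : ∀ x ∈ T, ∀ u ∈ S, G.Adj x u → u ∈ T := by
    intro x hx u hu hxu
    simp only [hT, Finset.mem_insert, Finset.mem_filter] at hx ⊢
    rcases hx with rfl | ⟨hx, hvx⟩
    · exact Or.inr ⟨hu, hxu⟩
    · exact Or.inl (hS.eq_of_adj_of_adj hx hu hv hxu hvx.symm)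
  have hone : ∀ u, u ∉ T → (T.filter (G.Adj u)).card ≤ if u ∈ S then 0 else 1 := by
    intro u hu
    split_ifs with huS
    · refine (Finset.card_eq_zero.2 (Finset.filter_eq_empty_iff.2 fun x hx hux => ?_)).le
      exact hu (hTclosed x hx u huS hux.symm)
    · refine Finset.card_le_one.2 fun x hx y hy => ?_
      rw [Finset.mem_filter] at hx hy
      by_contra hxy
      exact htri {u, x, y} (is3Clique_triple_iff.2 ⟨hx.2, hy.2, hTadj x hx.1 y hy.1 hxy⟩)
  have hval : ∀ u ∈ T,
      0 < G.fireScript (indicatorScript Sᶜ) (indicatorScript Tᶜ) u := by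
    intro u hu
    rw [fireScript_indicator_of_notMem _ (by simpa using hu)]
    have h1 : 0 ≤ (indicatorScript Sᶜ : V → ℤ) u := h0 u
    -- At most one neighbor of `u` is in `T` and the degree is at least two, so a chip arrives from
    -- outside.
    have h2 : 0 < (Tᶜ.filter (G.Adj u)).card := by
      have h3 : (T.filter (G.Adj u)).card ≤ 1 := Finset.card_le_one.2 fun x hx y hy => by
        rw [Finset.mem_filter] at hx hy
        exact hS.eq_of_adj_of_adj (hTS hu) (hTS hx.1) (hTS hy.1) hx.2 hy.2
      have h4 : (T.filter (G.Adj u)).card + (Tᶜ.filter (G.Adj u)).card = G.degree u := by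
        rw [← G.card_neighborFinset_eq_degree, neighborFinset_eq_filter,
          ← Finset.card_union_of_disjoint
            (Finset.disjoint_filter_filter disjoint_compl_right),
          ← Finset.filter_union, Finset.union_compl]
      have := G.minDegree_le_degree u
      omega
    omega
  refine ⟨indicatorScript Tᶜ, fun u => ?_, hval v (by simp [hT])⟩
  by_cases hu : u ∈ T
  · exact (hval u hu).le
  · rw [fireScript_indicator_of_mem _ (by simpa using hu), compl_compl]
    have := hone u hu
    simp only [indicatorScript, Finset.mem_compl, Pi.zero_apply]
    split_ifs at this ⊢ <;> simp_all

theorem gonality_add_componentIndepNum_le [Nonempty V] (htri : G.CliqueFree 3)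
    (hδ : 2 ≤ G.minDegree) : G.gonality + G.componentIndepNum 2 ≤ Fintype.card V := by
  obtain ⟨S, hS, hcard⟩ := G.exists_card_eq_componentIndepNum 2
  have h1 := G.gonality_isLeast.2
    ⟨indicatorScript Sᶜ, rfl, divisorRank_pos_of_isComponentIndepSet htri hδ hS⟩
  have h2 : divisorDegree (indicatorScript Sᶜ : V → ℤ) = (Sᶜ.card : ℤ) := by
    simp only [divisorDegree, indicatorScript, Finset.sum_boole, Finset.filter_univ_mem]
  rw [h2] at h1
  have := Finset.card_add_card_compl S
  omega

theorem minDegree_le_componentIndepNum [Nonempty V] (htri : G.CliqueFree 3) :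
    G.minDegree ≤ G.componentIndepNum 2 := by
  let v := Classical.arbitrary V
  have h : G.IsComponentIndepSet 2 (G.neighborFinset v) :=
    isComponentIndepSet_of_forall_not_adj (by norm_num) fun x hx y hy hxy => by
      rw [mem_neighborFinset] at hx hy
      exact htri {v, x, y} (is3Clique_triple_iff.2 ⟨hx, hy, hxy⟩)
  have := h.card_le_componentIndepNum
  rw [G.card_neighborFinset_eq_degree] at this
  exact (G.minDegree_le_degree v).trans this

end Dissociation

/-! ### Mantel's bound and the lower bound on scramble number -/

section Scramble

variable {V : Type*} [Fintype V] [DecidableEq V] {G : SimpleGraph V} [DecidableRel G.Adj]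

/-- Mantel's bound for the edges inside a vertex set. -/
theorem two_mul_card_interedges_self_le (htri : G.CliqueFree 3) (A : Finset V) :
    2 * (G.interedges A A).card ≤ A.card ^ 2 := by
  -- `interedges A A` counts ordered pairs, hence the bound a²/2 rather than a²/4. Adjacent vertices
  -- have disjoint neighborhoods, which bounds ∑ d²; Cauchy–Schwarz then bounds ∑ d.
  let d : V → ℕ := fun v => (A.filter (G.Adj v)).card
  have hsum : (G.interedges A A).card = ∑ a ∈ A, d a := card_interedges_eq_sum A A
  have hsq : ∑ a ∈ A, d a ^ 2 = ∑ a ∈ A, ∑ b ∈ A, if G.Adj a b then d a else 0 :=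
    Finset.sum_congr rfl fun a _ => by
      rw [← Finset.sum_filter, Finset.sum_const, smul_eq_mul, sq]
  have hsq' : ∑ a ∈ A, d a ^ 2 = ∑ a ∈ A, ∑ b ∈ A, if G.Adj a b then d b else 0 := by
    rw [hsq, Finset.sum_comm]
    simp only [G.adj_comm]
  have hedge : ∀ a b, G.Adj a b → d a + d b ≤ A.card := fun a b hab => by
    rw [← Finset.card_union_of_disjoint]
    · exact Finset.card_le_card
        (Finset.union_subset (Finset.filter_subset _ _) (Finset.filter_subset _ _))
    · refine Finset.disjoint_left.2 fun x hx hy => ?_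
      rw [Finset.mem_filter] at hx hy
      exact htri {a, b, x} (is3Clique_triple_iff.2 ⟨hab, hx.2, hy.2⟩)
  have h1 : 2 * ∑ a ∈ A, d a ^ 2 ≤ A.card * ∑ a ∈ A, d a := by
    calc 2 * ∑ a ∈ A, d a ^ 2
        = ∑ a ∈ A, ∑ b ∈ A, if G.Adj a b then d a + d b else 0 := by
          rw [two_mul]
          nth_rewrite 1 [hsq]
          rw [hsq', ← Finset.sum_add_distrib]
          refine Finset.sum_congr rfl fun a _ => ?_
          rw [← Finset.sum_add_distrib]
          exact Finset.sum_congr rfl fun b _ => by split_ifs <;> rfl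
      _ ≤ ∑ a ∈ A, ∑ b ∈ A, if G.Adj a b then A.card else 0 := by
          refine Finset.sum_le_sum fun a _ => Finset.sum_le_sum fun b _ => ?_
          split_ifs with h
          · exact hedge a b h
          · rfl
      _ = A.card * ∑ a ∈ A, d a := by
          rw [Finset.mul_sum]
          refine Finset.sum_congr rfl fun a _ => ?_
          rw [← Finset.sum_filter, Finset.sum_const, smul_eq_mul, mul_comm]
  have h2 : (∑ a ∈ A, d a) ^ 2 ≤ A.card * ∑ a ∈ A, d a ^ 2 := sq_sum_le_card_mul_sum_sq
  rw [hsum]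
  rcases Nat.eq_zero_or_pos (∑ a ∈ A, d a) with h | h
  · rw [h]; simp
  · refine Nat.le_of_mul_le_mul_right ?_ h
    calc (2 * ∑ a ∈ A, d a) * ∑ a ∈ A, d a = 2 * (∑ a ∈ A, d a) ^ 2 := by ring
      _ ≤ A.card * (2 * ∑ a ∈ A, d a ^ 2) := by linarith
      _ ≤ A.card * (A.card * ∑ a ∈ A, d a) := Nat.mul_le_mul_left _ h1
      _ = _ := by ring

theorem minDegree_mul_card_le (A : Finset V) :
    G.minDegree * A.card ≤ (G.interedges A A).card + (G.interedges A Aᶜ).card := by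
  rw [card_interedges_eq_sum, card_interedges_eq_sum, ← Finset.sum_add_distrib, mul_comm,
    ← smul_eq_mul]
  refine Finset.card_nsmul_le_sum _ _ _ fun a _ => ?_
  rw [← Finset.card_union_of_disjoint (Finset.disjoint_filter_filter disjoint_compl_right),
    ← Finset.filter_union, Finset.union_compl, ← neighborFinset_eq_filter,
    G.card_neighborFinset_eq_degree]
  exact G.minDegree_le_degree a

/-- A cut whose smaller side has at least three vertices has at least `n - δ(G)` edges. -/
theorem card_sub_minDegree_le_card_interedges (htri : G.CliqueFree 3)
    (hδ : Fintype.card V + 3 ≤ 3 * G.minDegree) {A : Finset V} (hA : 3 ≤ A.card)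
    (hA' : 2 * A.card ≤ Fintype.card V) :
    Fintype.card V ≤ (G.interedges A Aᶜ).card + G.minDegree := by
  have h1 := two_mul_card_interedges_self_le htri A
  have h2 := G.minDegree_mul_card_le A
  generalize (G.interedges A A).card = i at *
  generalize (G.interedges A Aᶜ).card = e at *
  generalize A.card = a at *
  generalize G.minDegree = δ at *
  generalize Fintype.card V = n at *
  zify at *
  -- The claim reduces to (a+1)δ - a²/2 ≥ n. With δ ≥ (n+3)/3 the left side is concave in a, so the
  -- product (a-3)(n-2a) ≥ 0 handles the whole range.
  nlinarith [mul_le_mul_of_nonneg_left hδ (show (0 : ℤ) ≤ a + 1 by omega),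
    mul_nonneg (sub_nonneg.2 hA) (sub_nonneg.2 hA')]

theorem card_sub_minDegree_le_card_interedges_of_le (htri : G.CliqueFree 3)
    (hδ : Fintype.card V + 3 ≤ 3 * G.minDegree) {A : Finset V} (hA : 3 ≤ A.card)
    (hA' : 3 ≤ Aᶜ.card) :
    Fintype.card V ≤ (G.interedges A Aᶜ).card + G.minDegree := by
  have := Finset.card_add_card_compl A
  rcases le_total A.card Aᶜ.card with h | h
  · exact card_sub_minDegree_le_card_interedges htri hδ hA (by omega)
  · have h1 := card_sub_minDegree_le_card_interedges htri hδ hA' (by omega)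
    rw [compl_compl] at h1
    have h2 : (G.interedges Aᶜ A).card = (G.interedges A Aᶜ).card :=
      letI := G.symm
      Rel.card_interedges_comm (r := G.Adj) _ _
    omega

/-- The scramble of all connected vertex sets with at least three vertices. -/
def threeScramble (G : SimpleGraph V) : Set (Finset V) :=
  {E | (G.induce (E : Set V)).Connected ∧ 3 ≤ E.card}

/-- A component of the complement with three or more vertices would itself be an egg that `C`
misses. -/
theorem IsHittingSet.isComponentIndepSet_compl {C : Finset V}
    (hC : IsHittingSet G.threeScramble C) : G.IsComponentIndepSet 2 Cᶜ := by
  classical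
  intro c
  by_contra! hc
  set T : Set V := Subtype.val '' c.supp with hT
  have hTC : ∀ x ∈ T, x ∉ C := by
    rintro _ ⟨x, -, rfl⟩
    simpa using x.2
  have hcard : T.ncard = c.supp.ncard := Set.ncard_image_of_injective _ Subtype.val_injective
  have hconn : (G.induce T).Connected := by
    have h1 := c.connected_toSimpleGraph
    exact h1.map
      (⟨fun x => ⟨x.1.1, x.1, x.2, rfl⟩, fun h => h⟩ : c.toSimpleGraph →g G.induce T)
      (by rintro ⟨_, x, hx, rfl⟩; exact ⟨⟨x, hx⟩, rfl⟩)
  have hmem : T.toFinset ∈ G.threeScramble := by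
    refine ⟨by rwa [Set.coe_toFinset], ?_⟩
    rw [← Set.ncard_eq_toFinset_card']
    omega
  obtain ⟨x, hx⟩ := hC _ hmem
  rw [Finset.mem_inter, Set.mem_toFinset] at hx
  exact hTC x hx.2 hx.1

theorem card_sub_componentIndepNum_le_scrambleNumber [Nonempty V] (htri : G.CliqueFree 3)
    (hδ : Fintype.card V + 3 ≤ 3 * G.minDegree) :
    ((Fintype.card V - G.componentIndepNum 2 : ℕ) : ℕ∞) ≤ G.scrambleNumber := by
  refine le_trans ?_ (le_iSup₂_of_le G.threeScramble (fun E hE => hE.1) le_rfl)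
  refine le_min (le_iInf₂ fun C hC => ?_) (le_iInf₂ fun A hA => ?_)
  · have h1 := (IsHittingSet.isComponentIndepSet_compl hC).card_le_componentIndepNum
    have := Finset.card_add_card_compl C
    exact_mod_cast (by omega : Fintype.card V - G.componentIndepNum 2 ≤ C.card)
  · obtain ⟨⟨E, hE, hEA⟩, ⟨F, hF, hFA⟩⟩ := hA
    have h1 := card_sub_minDegree_le_card_interedges_of_le htri hδ
      (hE.2.trans (Finset.card_le_card hEA)) (hF.2.trans (Finset.card_le_card hFA))
    have h2 := G.minDegree_le_componentIndepNum htri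
    exact_mod_cast (by omega :
      Fintype.card V - G.componentIndepNum 2 ≤ (G.interedges A Aᶜ).card)

end Scramble

end SimpleGraph

theorem mainTheorem5 {V : Type*} [Fintype V] [DecidableEq V] (G : SimpleGraph V)
    [DecidableRel G.Adj] (hconn : G.Connected) (htri : G.CliqueFree 3)
    (hn : 6 ≤ Fintype.card V) (hδ : (Fintype.card V : ℝ) / 3 + 1 ≤ (G.minDegree : ℝ)) :
    G.scrambleNumber = (G.gonality : ℕ∞) ∧
      (G.gonality : ℤ) = (Fintype.card V : ℤ) - (G.componentIndepNum 2 : ℤ) := by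
  have := hconn.nonempty
  have hδ' : Fintype.card V + 3 ≤ 3 * G.minDegree := by
    have : (Fintype.card V : ℝ) + 3 ≤ 3 * (G.minDegree : ℝ) := by linarith
    exact_mod_cast this
  have h1 := SimpleGraph.card_sub_componentIndepNum_le_scrambleNumber htri hδ'
  have h2 := G.scrambleNumber_le_gonality
  have h3 := SimpleGraph.gonality_add_componentIndepNum_le htri (by omega : 2 ≤ G.minDegree)
  have h4 : Fintype.card V - G.componentIndepNum 2 ≤ G.gonality := by
    exact_mod_cast h1.trans h2
  -- `h3` also gives α ≤ n, so the natural subtraction is not truncated.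
  have h5 : Fintype.card V - G.componentIndepNum 2 = G.gonality := by omega
  exact ⟨le_antisymm h2 (h5 ▸ h1), by omega⟩
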